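/- **Notation.** Label the affine Dynkin diagram of type $E_7^{(1)}$ by $I=\{0,1,\dots,7\}$, with edges $0-1-3-4-5-6-7$ and $4-2$; let $A$ be its Cartan matrix, $\omega_i$ the fundamental weights, and $P=\bigoplus_{i\in I}\mathbb Z\omega_i$. For $K\subseteq I$, a $K$-crystal is a set $B$ with maps $e_i,f_i\colon B\to B\sqcup\{0\}$ ($i\in K$) and $\mathrm{wt}\colon B\to P_K=\bigoplus_{i\in K}\mathbb Z\omega_i$ such that $\varepsilon_i(b)=\max\{k\mid e_i^kb\ne 0\}$ and $\varphi_i(b)=\max\{k\mid f_i^kb\neq 0\}$ exist, $\varphi_i(b)=\varepsilon_i(b)+\langle\alpha_i^\vee,\mathrm{wt}(b)\rangle$, $f_ib=b'$ if and only if $b=e_ib'$, and $\mathrm{wt}(f_ib)=\mathrm{wt}(b)-\alpha_i$ whenever $f_ib\ne0$. An affine type $E_7^{(1)}$ crystal is an $I$-crystal; $B|_K$ denotes its restriction to $K$, with weights projected to $P_K$. A morphism of crystals $\psi\colon B_1\to B_2$ is a map $B_1\sqcup\{0\}\to B_2\sqcup\{0\}$ with $\psi(0)=0$ that preserves $\mathrm{wt},\varepsilon_i,\varphi_i$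 of every $b$ with $\psi(b)\neq0$ and satisfies $\psi(e_ib)=e_i\psi(b)$ and $\psi(f_ib)=f_i\psi(b)$ whenever both sides are nonzero; it is an isomorphism if it is a bijection $B_1\sqcup\{0\}\to B_2\sqcup\{0\}$. Let $I_0=I\setminus\{0\}$ (type $E_7$) and $I_2=I\setminus\{2\}$ (type $A_7$), let $B(\lambda)$ denote the highest weight crystal of highest weight $\lambda$, let $\overline\omega_7$ be the fundamental weight of $E_7$ at the node $7$, and let $\varpi_1,\dots,\varpi_7$ be the fundamental weights of $A_7$, attached to the nodes $7,6,5,4,3,1,0$ in this order. **Theorem.** Let $s\ge 0$ be an integer, and let $\mathcal B$ and $\mathcal B'$ be affine type $E_7^{(1)}$ crystals with an $I_2$-crystal isomorphism $\Psi_{I_2}\colon\mathcal B|_{I_2}\to\mathcal B'|_{I_2}$ and an $I_0$-crystal isomorphism $\Psi_{I_0}\colon\mathcal B|_{I_0}\to\mathcal B'|_{I_0}$. Suppose that $$\mathcal B'|_{I_2}\cong\bigoplus_{\mu}B(\mu)\qquad\text{and}\qquad\mathcal B'|_{I_0}\cong B(s\overline\omega_7),$$ where the sum is over all weights $\mu=(m_7-m_4-m_5)\varpi_6+m_5\varpi_4+m_6\varpi_2$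 (each taken once) with integers $m_4,m_5,m_6,m_7\ge0$ such that $m_4+m_5\le m_7$ and $m_4+m_5+m_6+m_7=s$. Then $\Psi_{I_2}(b)=\Psi_{I_0}(b)$ for all $b\in\mathcal B$. Moreover, there is an $I$-crystal isomorphism $\Psi\colon\mathcal B\to\mathcal B'$, which can be taken with $\Psi(b)=\Psi_{I_0}(b)=\Psi_{I_2}(b)$ for all $b\in\mathcal B$. -/

import Mathlib

universe u v w

namespace E7Crystal

/-- The data underlying an abstract crystal with index set `J`: a set with partial crystal operators
`e i`, `f i` (the value `none` is the extra element `0`) and a weight function. A weight is recorded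
by its coordinates `j ↦ ⟨α_jᵛ, wt⟩`, i.e. the weight lattice is `⨁_j ℤ ω_j`. -/
structure CrystalData (J : Type v) where
  carrier : Type u
  e : J → carrier → Option carrier
  f : J → carrier → Option carrier
  wt : carrier → J → ℤ

/-- The simple root `α_i`, as the weight with coordinates `⟨α_jᵛ, α_i⟩ = A j i`. -/
def simpleRoot {J : Type v} (A : Matrix J J ℤ) (i : J) : J → ℤ := fun j => A j i

namespace CrystalData

variable {J : Type v}

/-- The set `{k | e_i^k b ≠ 0}`. -/
def eSet (C : CrystalData.{u} J) (i : J) (b : C.carrier) : Set ℕ :=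
  {k | (fun x : Option C.carrier => x.bind (C.e i))^[k] (some b) ≠ none}

/-- The set `{k | f_i^k b ≠ 0}`. -/
def fSet (C : CrystalData.{u} J) (i : J) (b : C.carrier) : Set ℕ :=
  {k | (fun x : Option C.carrier => x.bind (C.f i))^[k] (some b) ≠ none}

/-- `ε_i(b) = max {k | e_i^k b ≠ 0}`. -/
noncomputable def eps (C : CrystalData.{u} J) (i : J) (b : C.carrier) : ℕ := sSup (C.eSet i b)

/-- `φ_i(b) = max {k | f_i^k b ≠ 0}`. -/
noncomputable def phi (C : CrystalData.{u} J) (i : J) (b : C.carrier) : ℕ := sSup (C.fSet i b)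

/-- The axioms of an abstract (seminormal) crystal for the Cartan matrix `A`. The first two say
that the maxima defining `ε_i` and `φ_i` exist. -/
structure IsCrystal (A : Matrix J J ℤ) (C : CrystalData.{u} J) : Prop where
  bdd_eSet : ∀ i b, BddAbove (C.eSet i b)
  bdd_fSet : ∀ i b, BddAbove (C.fSet i b)
  phi_eq : ∀ i b, (C.phi i b : ℤ) = (C.eps i b : ℤ) + C.wt b i
  f_eq_iff : ∀ i b b', C.f i b = some b' ↔ C.e i b' = some b
  wt_f : ∀ i b b', C.f i b = some b' → C.wt b' = C.wt b - simpleRoot A i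

/-- The restriction `C|_K` to a subset `K` of the index set: the operators and the weight
coordinates outside `K` are forgotten. -/
def restrict (C : CrystalData.{u} J) (K : Set J) : CrystalData.{u} K where
  carrier := C.carrier
  e i := C.e i
  f i := C.f i
  wt b i := C.wt b i

/-- A crystal morphism: a map `ψ : C ⊔ {0} → D ⊔ {0}` with `ψ 0 = 0`, compatible with weights,
`ε_i`, `φ_i`, and with the crystal operators wherever both sides are nonzero. -/
structure Morphism (C : CrystalData.{u} J) (D : CrystalData.{w} J) where
  toFun : Option C.carrier → Option D.carrier
  map_zero : toFun none = none
  wt_eq : ∀ b b', toFun (some b) = some b' → D.wt b' = C.wt b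
  eps_eq : ∀ i b b', toFun (some b) = some b' → D.eps i b' = C.eps i b
  phi_eq : ∀ i b b', toFun (some b) = some b' → D.phi i b' = C.phi i b
  map_e : ∀ i b, toFun (C.e i b) ≠ none → (toFun (some b)).bind (D.e i) ≠ none →
    toFun (C.e i b) = (toFun (some b)).bind (D.e i)
  map_f : ∀ i b, toFun (C.f i b) ≠ none → (toFun (some b)).bind (D.f i) ≠ none →
    toFun (C.f i b) = (toFun (some b)).bind (D.f i)

/-- A crystal isomorphism: a crystal morphism that is a bijection `C ⊔ {0} → D ⊔ {0}`. -/
structure Iso (C : CrystalData.{u} J) (D : CrystalData.{w} J) extends Morphism C D where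
  bijective : Function.Bijective toFun

/-- The direct sum (disjoint union) of a family of crystals. -/
def directSum {ι : Type} (C : ι → CrystalData.{0} J) : CrystalData.{0} J where
  carrier := Σ t, (C t).carrier
  e i b := ((C b.1).e i b.2).map (Sigma.mk b.1)
  f i b := ((C b.1).f i b.2).map (Sigma.mk b.1)
  wt b := (C b.1).wt b.2

/-- The tensor product `C ⊗ D`. This is the signature rule for two factors: among
`-^{φ(b)} +^{ε(b)} -^{φ(c)} +^{ε(c)}` the pairs `+-` are deleted, `f_i` acts on the factor of the
rightmost remaining `-` and `e_i` on the factor of the leftmost remaining `+`. -/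
noncomputable def tensor (C D : CrystalData.{0} J) : CrystalData.{0} J where
  carrier := C.carrier × D.carrier
  e i x := if D.phi i x.2 < C.eps i x.1 then (C.e i x.1).map (fun b => (b, x.2))
    else (D.e i x.2).map (fun c => (x.1, c))
  f i x := if C.eps i x.1 < D.phi i x.2 then (D.f i x.2).map (fun c => (x.1, c))
    else (C.f i x.1).map (fun b => (b, x.2))
  wt x := C.wt x.1 + D.wt x.2

/-- The one-element crystal of weight `0`, the empty tensor product. -/
def trivialCrystal : CrystalData.{0} J where
  carrier := Unit
  e _ _ := none
  f _ _ := none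
  wt _ := 0

/-- Membership in the connected component of `x`. -/
inductive InComponent (C : CrystalData.{u} J) (x : C.carrier) : C.carrier → Prop
  | base : InComponent C x x
  | e {i : J} {b b' : C.carrier} : InComponent C x b → C.e i b = some b' → InComponent C x b'
  | f {i : J} {b b' : C.carrier} : InComponent C x b → C.f i b = some b' → InComponent C x b'

/-- The connected component of `x`, i.e. the subcrystal generated by `x`. -/
def component (C : CrystalData.{u} J) (x : C.carrier) : CrystalData.{u} J where
  carrier := {b : C.carrier // C.InComponent x b}
  e i b := (C.e i b.1).pmap Subtype.mk (fun _ h => b.2.e h)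
  f i b := (C.f i b.1).pmap Subtype.mk (fun _ h => b.2.f h)
  wt b := C.wt b.1

end CrystalData

section HighestWeight

variable {J : Type} [DecidableEq J]

/-- The simple reflection `s_i μ = μ - ⟨α_iᵛ, μ⟩ α_i` on weights. -/
def simpleReflection (A : Matrix J J ℤ) (i : J) (μ : J → ℤ) : J → ℤ :=
  μ - μ i • simpleRoot A i

/-- The Weyl group orbit of the weight `lam`. -/
inductive WeylOrbit (A : Matrix J J ℤ) (lam : J → ℤ) : (J → ℤ) → Prop
  | base : WeylOrbit A lam lam
  | reflect (i : J) {μ : J → ℤ} : WeylOrbit A lam μ → WeylOrbit A lam (simpleReflection A i μ)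

/-- The highest weight crystal `B(ω_r)` of a minuscule fundamental weight `ω_r`: its elements
are the weights in the Weyl orbit of `ω_r`, on which all `⟨α_iᵛ, μ⟩` are in `{-1, 0, 1}`;
`f_i` sends `μ` to `s_i μ = μ - α_i` if `⟨α_iᵛ, μ⟩ = 1` and to `0` otherwise, and
`e_i` sends `μ` to `s_i μ = μ + α_i` if `⟨α_iᵛ, μ⟩ = -1` and to `0` otherwise.
In type `A_n` this is the crystal of columns of a fixed height (of one-column tableaux). -/
def minuscule (A : Matrix J J ℤ) (r : J) : CrystalData.{0} J where
  carrier := {μ : J → ℤ // WeylOrbit A (Pi.single r 1) μ}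
  e i μ := if μ.1 i = -1 then some ⟨simpleReflection A i μ.1, μ.2.reflect i⟩ else none
  f i μ := if μ.1 i = 1 then some ⟨simpleReflection A i μ.1, μ.2.reflect i⟩ else none
  wt μ := μ.1

/-- The tensor product `B(ω_{r₁}) ⊗ ⋯ ⊗ B(ω_{rₖ})` of minuscule crystals. -/
noncomputable def minusculeTensor (A : Matrix J J ℤ) : List J → CrystalData.{0} J
  | [] => CrystalData.trivialCrystal
  | r :: l => (minuscule A r).tensor (minusculeTensor A l)

/-- The element `u_{ω_{r₁}} ⊗ ⋯ ⊗ u_{ω_{rₖ}}`. -/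
noncomputable def minusculeTensorTop (A : Matrix J J ℤ) :
    (l : List J) → (minusculeTensor A l).carrier
  | [] => ()
  | r :: l => (⟨Pi.single r 1, .base⟩, minusculeTensorTop A l)

/-- The highest weight crystal `B(ω_{r₁} + ⋯ + ω_{rₖ})`, for minuscule fundamental weights
`ω_{rⱼ}` (all those of type `A_n`, and `ω_7` in type `E_7`), generated by its highest weight
element `u_{ω_{r₁}} ⊗ ⋯ ⊗ u_{ω_{rₖ}}` inside `B(ω_{r₁}) ⊗ ⋯ ⊗ B(ω_{rₖ})`. In type `A_n`, with the
columns ordered from tallest to shortest, this is the crystal of semistandard tableaux with the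
column reading (columns left to right, each from bottom to top). -/
noncomputable def highestWeightCrystal (A : Matrix J J ℤ) (l : List J) : CrystalData.{0} J :=
  (minusculeTensor A l).component (minusculeTensorTop A l)

end HighestWeight

/-- The Cartan matrix of type `E_7^{(1)}`: the Dynkin diagram is the chain `0-1-3-4-5-6-7`
together with the edge `4-2`. -/
def cartanE7Affine : Matrix (Fin 8) (Fin 8) ℤ :=
  !![ 2, -1,  0,  0,  0,  0,  0,  0;
     -1,  2,  0, -1,  0,  0,  0,  0;
      0,  0,  2,  0, -1,  0,  0,  0;
      0, -1,  0,  2, -1,  0,  0,  0;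
      0,  0, -1, -1,  2, -1,  0,  0;
      0,  0,  0,  0, -1,  2, -1,  0;
      0,  0,  0,  0,  0, -1,  2, -1;
      0,  0,  0,  0,  0,  0, -1,  2]

/-- `I_0 = I \ {0}`, of type `E_7`. -/
abbrev I₀ : Set (Fin 8) := {i | i ≠ 0}

/-- `I_2 = I \ {2}`, of type `A_7`. -/
abbrev I₂ : Set (Fin 8) := {i | i ≠ 2}

/-- The Cartan matrix of the Levi subalgebra with index set `K`. -/
def leviCartan (K : Set (Fin 8)) : Matrix K K ℤ :=
  cartanE7Affine.submatrix Subtype.val Subtype.val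

/-- The `E_7` crystal `B(s ω_7)`. -/
noncomputable def crystalE7 (s : ℕ) : CrystalData.{0} I₀ :=
  highestWeightCrystal (leviCartan I₀) (List.replicate s ⟨7, by decide⟩)

/-- The parameters `m_4, m_5, m_6, m_7 ≥ 0` with `m_4 + m_5 ≤ m_7` and
`m_4 + m_5 + m_6 + m_7 = s`. (They are determined by `s` and the weight
`μ = (m_7 - m_4 - m_5) ϖ_6 + m_5 ϖ_4 + m_6 ϖ_2`.) -/
structure Param (s : ℕ) where
  m₄ : ℕ
  m₅ : ℕ
  m₆ : ℕ
  m₇ : ℕ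
  le : m₄ + m₅ ≤ m₇
  sum_eq : m₄ + m₅ + m₆ + m₇ = s

/-- The `A_7` crystal `⨁_μ B(μ)`, `μ = (m_7 - m_4 - m_5) ϖ_6 + m_5 ϖ_4 + m_6 ϖ_2`, where the
fundamental weights `ϖ_1, …, ϖ_7` of type `A_7` belong to the nodes `7, 6, 5, 4, 3, 1, 0`; in
particular `ϖ_6, ϖ_4, ϖ_2` belong to the nodes `1, 4, 6`. -/
noncomputable def crystalA7 (s : ℕ) : CrystalData.{0} I₂ :=
  CrystalData.directSum fun p : Param s =>
    highestWeightCrystal (leviCartan I₂)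
      (List.replicate (p.m₇ - (p.m₄ + p.m₅)) ⟨1, by decide⟩ ++
        List.replicate p.m₅ ⟨4, by decide⟩ ++ List.replicate p.m₆ ⟨6, by decide⟩)

end E7Crystal

/-! The nodes common to `I₀` and `I₂` form a chain of type `A_6`, and both isomorphisms respect the
`A_6` structure. If the `A_7` crystal is multiplicity free over `A_6`, an `A_6` highest weight
element has only one possible image under either map, because weight and vanishing of the `e_i` are
preserved. Every other element is reached by some `f_i` from one of larger weight, and both maps
commute with `f_i`, so they agree everywhere (`toFun_eq_toFun`). As the two index sets cover `I`,
the common map is an isomorphism for all nodes.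

Multiplicity freeness (`crystalA7_multiplicityFree`) is the branching rule from letters `1, …, 8` to
`1, …, 7`. Elements of `B(μ)` are semistandard tableaux (`tableau_of_inComponent`). In an `A_6`
highest weight tableau each column reads `1, …, q`, possibly followed by an `8`
(`Tableau.exists_hasShape`). The `A_6` weight counts the columns with each `q`. All column heights
are `2`, `4` or `6`, so `q` rounded up to an even number is the height, and both `μ` and the tableau
are recovered. -/

namespace E7Crystal

/-! ### String lengths, weight bounds and isomorphisms -/

namespace CrystalData

variable {J : Type w}

theorem iterate_bind_none {α : Type*} (g : α → Option α) (k : ℕ) :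
    (fun x : Option α => x.bind g)^[k] none = none := by
  induction k with
  | zero => rfl
  | succ k ih => rw [Function.iterate_succ_apply]; exact ih

theorem ne_none_of_one_le_sSup {α : Type*} {g : α → Option α} {b : α}
    (h : 1 ≤ sSup {k | (fun x : Option α => x.bind g)^[k] (some b) ≠ none}) : g b ≠ none := by
  intro hg
  have : sSup {k | (fun x : Option α => x.bind g)^[k] (some b) ≠ none} ≤ 0 := by
    apply csSup_le'
    intro k hk
    rcases k with _ | k
    · rfl
    · refine absurd ?_ hk
      rw [Function.iterate_succ_apply]
      simp only [Option.bind_some, hg]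
      exact iterate_bind_none g k
  omega

/-- Boundedness matters here: in `ℕ` the supremum of an unbounded set is `0`. Supplying it for the
model crystals is the purpose of `WtBounded`. -/
theorem one_le_sSup_of_ne_none {α : Type*} {g : α → Option α} {b : α}
    (hbdd : BddAbove {k | (fun x : Option α => x.bind g)^[k] (some b) ≠ none})
    (h : g b ≠ none) : 1 ≤ sSup {k | (fun x : Option α => x.bind g)^[k] (some b) ≠ none} :=
  le_csSup hbdd (by simpa using h)

theorem e_ne_none_of_eps {C : CrystalData.{u} J} {i : J} {b : C.carrier} (h : 1 ≤ C.eps i b) :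
    C.e i b ≠ none := ne_none_of_one_le_sSup h

theorem f_ne_none_of_phi {C : CrystalData.{u} J} {i : J} {b : C.carrier} (h : 1 ≤ C.phi i b) :
    C.f i b ≠ none := ne_none_of_one_le_sSup h

theorem one_le_eps {C : CrystalData.{u} J} {i : J} {b : C.carrier} (hb : BddAbove (C.eSet i b))
    (h : C.e i b ≠ none) : 1 ≤ C.eps i b := one_le_sSup_of_ne_none hb h

theorem one_le_phi {C : CrystalData.{u} J} {i : J} {b : C.carrier} (hb : BddAbove (C.fSet i b))
    (h : C.f i b ≠ none) : 1 ≤ C.phi i b := one_le_sSup_of_ne_none hb h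

/-- The weight coordinates are bounded by `n`, and `e_i`, `f_i` shift the `i`-th one by `±2`. -/
structure WtBounded (C : CrystalData.{u} J) (n : ℕ) : Prop where
  abs_wt_le : ∀ b i, |C.wt b i| ≤ n
  wt_e : ∀ i b b', C.e i b = some b' → C.wt b' i = C.wt b i + 2
  wt_f : ∀ i b b', C.f i b = some b' → C.wt b' i = C.wt b i - 2

theorem exists_shift_of_iterate {α : Type*} {g : α → Option α} {wt : α → ℤ} {d : ℤ}
    (hg : ∀ b b', g b = some b' → wt b' = wt b + d) (k : ℕ) (b : α)
    (h : (fun x : Option α => x.bind g)^[k] (some b) ≠ none) : ∃ b', wt b' = wt b + k * d := by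
  induction k generalizing b with
  | zero => exact ⟨b, by simp⟩
  | succ k ih =>
    rw [Function.iterate_succ_apply] at h
    simp only [Option.bind_some] at h
    cases hb : g b with
    | none => rw [hb, iterate_bind_none] at h; exact absurd rfl h
    | some c =>
      rw [hb] at h
      obtain ⟨b', hb'⟩ := ih c h
      exact ⟨b', by rw [hb', hg b c hb]; push_cast; ring⟩

namespace WtBounded

variable {C : CrystalData.{u} J} {n : ℕ}

theorem le_of_mem_eSet (h : C.WtBounded n) {i : J} {b : C.carrier} {k : ℕ} (hk : k ∈ C.eSet i b) :
    C.wt b i + 2 * k ≤ n := by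
  obtain ⟨b', hb'⟩ := exists_shift_of_iterate (wt := fun b => C.wt b i) (h.wt_e i) k b hk
  have := (abs_le.1 (h.abs_wt_le b' i)).2
  linarith

theorem le_of_mem_fSet (h : C.WtBounded n) {i : J} {b : C.carrier} {k : ℕ} (hk : k ∈ C.fSet i b) :
    2 * k ≤ n + C.wt b i := by
  obtain ⟨b', hb'⟩ := exists_shift_of_iterate (wt := fun b => C.wt b i) (d := -2)
    (fun b b' hb => by rw [h.wt_f i b b' hb]; ring) k b hk
  have := (abs_le.1 (h.abs_wt_le b' i)).1
  linarith

theorem bdd_eSet (h : C.WtBounded n) (i : J) (b : C.carrier) : BddAbove (C.eSet i b) := by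
  refine ⟨n, fun k hk => ?_⟩
  have := h.le_of_mem_eSet hk
  have := (abs_le.1 (h.abs_wt_le b i)).1
  omega

theorem bdd_fSet (h : C.WtBounded n) (i : J) (b : C.carrier) : BddAbove (C.fSet i b) := by
  refine ⟨n, fun k hk => ?_⟩
  have := h.le_of_mem_fSet hk
  have := (abs_le.1 (h.abs_wt_le b i)).2
  omega

theorem one_le_phi_iff (h : C.WtBounded n) {i : J} {b : C.carrier} :
    1 ≤ C.phi i b ↔ C.f i b ≠ none :=
  ⟨f_ne_none_of_phi, one_le_phi (h.bdd_fSet i b)⟩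

theorem one_le_eps_iff (h : C.WtBounded n) {i : J} {b : C.carrier} :
    1 ≤ C.eps i b ↔ C.e i b ≠ none :=
  ⟨e_ne_none_of_eps, one_le_eps (h.bdd_eSet i b)⟩

theorem mono (h : C.WtBounded n) {m : ℕ} (hnm : n ≤ m) : C.WtBounded m :=
  ⟨fun b i => (h.abs_wt_le b i).trans (by exact_mod_cast hnm), h.wt_e, h.wt_f⟩

theorem component (h : C.WtBounded n) (x : C.carrier) : (C.component x).WtBounded n where
  abs_wt_le b i := h.abs_wt_le b.1 i
  wt_e i b b' hb := by
    obtain ⟨a, h1, h2, rfl⟩ := Option.pmap_eq_some_iff.1 hb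
    exact h.wt_e i _ _ h2
  wt_f i b b' hb := by
    obtain ⟨a, h1, h2, rfl⟩ := Option.pmap_eq_some_iff.1 hb
    exact h.wt_f i _ _ h2

theorem directSum {ι : Type} {C : ι → CrystalData.{0} J} (h : ∀ t, (C t).WtBounded n) :
    (CrystalData.directSum C).WtBounded n where
  abs_wt_le b i := (h b.1).abs_wt_le b.2 i
  wt_e i b b' hb := by
    obtain ⟨a, h1, rfl⟩ := Option.map_eq_some_iff.1 hb
    exact (h b.1).wt_e i _ _ h1
  wt_f i b b' hb := by
    obtain ⟨a, h1, rfl⟩ := Option.map_eq_some_iff.1 hb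
    exact (h b.1).wt_f i _ _ h1

theorem tensor {C D : CrystalData.{0} J} {n m : ℕ} (hC : C.WtBounded n) (hD : D.WtBounded m) :
    (C.tensor D).WtBounded (n + m) where
  abs_wt_le b i := by
    have := (abs_add_le _ _).trans (add_le_add (hC.abs_wt_le b.1 i) (hD.abs_wt_le b.2 i))
    simpa [CrystalData.tensor] using this
  wt_e i b b' hb := by
    simp only [CrystalData.tensor] at hb ⊢
    split_ifs at hb <;> obtain ⟨a, h1, rfl⟩ := Option.map_eq_some_iff.1 hb
    · have := hC.wt_e i _ _ h1
      simp only [Pi.add_apply]; omega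
    · have := hD.wt_e i _ _ h1
      simp only [Pi.add_apply]; omega
  wt_f i b b' hb := by
    simp only [CrystalData.tensor] at hb ⊢
    split_ifs at hb <;> obtain ⟨a, h1, rfl⟩ := Option.map_eq_some_iff.1 hb
    · have := hD.wt_f i _ _ h1
      simp only [Pi.add_apply]; omega
    · have := hC.wt_f i _ _ h1
      simp only [Pi.add_apply]; omega

end WtBounded

namespace Iso

variable {C : CrystalData.{u} J} {D : CrystalData.{v} J}

theorem map_some (ψ : C.Iso D) (b : C.carrier) : ∃ b', ψ.toFun (some b) = some b' := by
  cases h : ψ.toFun (some b) with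
  | some b' => exact ⟨b', rfl⟩
  | none => exact absurd (ψ.bijective.1 (h.trans ψ.map_zero.symm)) (by simp)

theorem e_eq_none (ψ : C.Iso D) {i : J} {b : C.carrier} {b' : D.carrier}
    (hD : BddAbove (D.eSet i b')) (hb : ψ.toFun (some b) = some b') (h : C.e i b = none) :
    D.e i b' = none := by
  by_contra h'
  have := one_le_eps hD h'
  rw [ψ.eps_eq i b b' hb] at this
  exact e_ne_none_of_eps this h

/-- A morphism commutes with `f_i` only where both sides are nonzero. Preservation of `φ_i` gives
nonvanishing on the target side, and injectivity on the source side. -/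
theorem map_f_of_ne_none (ψ : C.Iso D) {i : J} {b : C.carrier} (hC : BddAbove (C.fSet i b))
    (h : C.f i b ≠ none) : ψ.toFun (C.f i b) = (ψ.toFun (some b)).bind (D.f i) := by
  obtain ⟨b', hb'⟩ := ψ.map_some b
  obtain ⟨c, hc⟩ := Option.ne_none_iff_exists'.1 h
  obtain ⟨c', hc'⟩ := ψ.map_some c
  apply ψ.map_f i b
  · rw [hc, hc']; simp
  · rw [hb']
    have := one_le_phi hC h
    rw [← ψ.phi_eq i b b' hb'] at this
    exact f_ne_none_of_phi this

end Iso

end CrystalData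

open CrystalData

/-! ### Columns of type `A_7` as counting functions -/

/-- The position of a node in the chain `7, 6, 5, 4, 3, 1, 0` of type `A_7`. -/
def chainPos (i : Fin 8) : ℕ := (![6, 5, 7, 4, 3, 2, 1, 0] : Fin 8 → ℕ) i

theorem chainPos_lt (i : I₂) : chainPos i.1 < 7 := by
  have : ∀ i : Fin 8, i ≠ 2 → chainPos i < 7 := by decide
  exact this i.1 i.2

theorem chainPos_injective {i j : I₂} (h : chainPos i.1 = chainPos j.1) : i = j := by
  -- Node `2` is off the chain; its value `7` keeps the map injective on all of `Fin 8`.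
  have : ∀ i j : Fin 8, chainPos i = chainPos j → i = j := by decide
  exact Subtype.ext (this _ _ h)

theorem exists_chainPos {p : ℕ} (hp : p < 7) : ∃ i : I₂, chainPos i.1 = p := by
  have : ∀ p : Fin 7, ∃ i : Fin 8, i ≠ 2 ∧ chainPos i = p := by decide
  obtain ⟨i, hi, h⟩ := this ⟨p, hp⟩
  exact ⟨⟨i, hi⟩, h⟩

theorem chainPos_zero_iff (i : I₂) : i.1 ≠ 0 ↔ chainPos i.1 < 6 := by
  have : ∀ i : Fin 8, i ≠ 2 → (i ≠ 0 ↔ chainPos i < 6) := by decide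
  exact this i.1 i.2

theorem leviCartan_I₂ (i j : I₂) : leviCartan I₂ j i =
    if chainPos j.1 = chainPos i.1 then 2
    else if chainPos j.1 = chainPos i.1 + 1 ∨ chainPos i.1 = chainPos j.1 + 1 then -1 else 0 := by
  have : ∀ i j : Fin 8, i ≠ 2 → j ≠ 2 → cartanE7Affine j i =
    if chainPos j = chainPos i then 2
    else if chainPos j = chainPos i + 1 ∨ chainPos i = chainPos j + 1 then -1 else 0 := by decide
  exact this i.1 j.1 i.2 j.2

/-- `N` is the counting function of a column of height `h` with letters in `{1, …, 8}`: the number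
of letters `≤ k` in the column is `N k`. -/
structure IsColumn (h : ℤ) (N : ℕ → ℤ) : Prop where
  zero : N 0 = 0
  eight : N 8 = h
  mono : ∀ k < 8, N k ≤ N (k + 1)
  le_succ : ∀ k < 8, N (k + 1) ≤ N k + 1

/-- The `i`-th weight coordinate of the column with counting function `N`. -/
def columnWt (N : ℕ → ℤ) (i : I₂) : ℤ :=
  2 * N (chainPos i.1 + 1) - N (chainPos i.1) - N (chainPos i.1 + 2)

theorem IsColumn.nonneg {h : ℤ} {N : ℕ → ℤ} (hN : IsColumn h N) {k : ℕ} (hk : k ≤ 8) :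
    0 ≤ N k := by
  induction k with
  | zero => exact hN.zero.ge
  | succ k ih => exact (ih (by omega)).trans (hN.mono k (by omega))

theorem IsColumn.le_self {h : ℤ} {N : ℕ → ℤ} (hN : IsColumn h N) {k : ℕ} (hk : k ≤ 8) :
    N k ≤ k := by
  induction k with
  | zero => exact hN.zero.le
  | succ k ih =>
    have := ih (by omega)
    have := hN.le_succ k (by omega)
    push_cast
    omega

theorem IsColumn.abs_columnWt_le {h : ℤ} {N : ℕ → ℤ} (hN : IsColumn h N) (i : I₂) :
    |columnWt N i| ≤ 1 := by
  have hp := chainPos_lt i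
  have h1 := hN.mono (chainPos i.1) (by omega)
  have h2 := hN.le_succ (chainPos i.1) (by omega)
  have h3 := hN.mono (chainPos i.1 + 1) (by omega)
  have h4 := hN.le_succ (chainPos i.1 + 1) (by omega)
  rw [abs_le]
  unfold columnWt
  constructor <;> linarith

/-- The counting function after the simple reflection `s_i`. -/
def reflectColumn (N : ℕ → ℤ) (i : I₂) : ℕ → ℤ :=
  Function.update N (chainPos i.1 + 1) (N (chainPos i.1 + 1) - columnWt N i)

theorem reflectColumn_self (N : ℕ → ℤ) (i : I₂) :
    reflectColumn N i (chainPos i.1 + 1) = N (chainPos i.1 + 1) - columnWt N i := by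
  simp [reflectColumn]

theorem reflectColumn_of_ne (N : ℕ → ℤ) (i : I₂) {k : ℕ} (hk : k ≠ chainPos i.1 + 1) :
    reflectColumn N i k = N k := by
  simp [reflectColumn, hk]

/-- With `p = chainPos i`, the value at `p + 1` becomes `N p + N (p + 2) - N (p + 1)`: the letters
`p + 1` and `p + 2` are exchanged. -/
theorem IsColumn.reflect {h : ℤ} {N : ℕ → ℤ} (hN : IsColumn h N) (i : I₂) :
    IsColumn h (reflectColumn N i) := by
  have hp := chainPos_lt i
  have key : ∀ k < 8, reflectColumn N i k ≤ reflectColumn N i (k + 1) ∧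
      reflectColumn N i (k + 1) ≤ reflectColumn N i k + 1 := by
    intro k hk
    have h1 := hN.mono k hk
    have h2 := hN.le_succ k hk
    by_cases hk1 : k = chainPos i.1
    · have h3 := hN.mono (k + 1) (by omega)
      have h4 := hN.le_succ (k + 1) (by omega)
      subst hk1
      rw [reflectColumn_self, reflectColumn_of_ne _ _ (by omega)]
      unfold columnWt
      constructor <;> linarith
    · by_cases hk2 : k = chainPos i.1 + 1
      · have h3 := hN.mono (chainPos i.1) (by omega)
        have h4 := hN.le_succ (chainPos i.1) (by omega)
        subst hk2
        rw [reflectColumn_self, reflectColumn_of_ne _ _ (by omega)]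
        unfold columnWt
        constructor <;> linarith
      · rw [reflectColumn_of_ne _ _ hk2, reflectColumn_of_ne _ _ (by omega)]
        exact ⟨h1, h2⟩
  refine ⟨?_, ?_, fun k hk => (key k hk).1, fun k hk => (key k hk).2⟩
  · rw [reflectColumn_of_ne _ _ (by omega), hN.zero]
  · rw [reflectColumn_of_ne _ _ (by omega), hN.eight]

theorem columnWt_reflect (N : ℕ → ℤ) (i : I₂) :
    columnWt (reflectColumn N i) = simpleReflection (leviCartan I₂) i (columnWt N) := by
  funext j
  simp only [simpleReflection, simpleRoot, Pi.sub_apply, Pi.smul_apply, smul_eq_mul,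
    leviCartan_I₂]
  by_cases h1 : chainPos j.1 = chainPos i.1
  · obtain rfl := chainPos_injective h1
    simp only [if_true]
    rw [columnWt, reflectColumn_self, reflectColumn_of_ne _ _ (by omega),
      reflectColumn_of_ne _ _ (by omega), columnWt]
    ring
  · rw [if_neg h1]
    by_cases h2 : chainPos j.1 = chainPos i.1 + 1
    · rw [if_pos (Or.inl h2), columnWt, h2, reflectColumn_self, reflectColumn_of_ne _ _ (by omega),
        reflectColumn_of_ne _ _ (by omega), columnWt, columnWt, h2]
      ring
    · by_cases h3 : chainPos i.1 = chainPos j.1 + 1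
      · have h4 : chainPos j.1 + 2 = chainPos i.1 + 1 := by omega
        rw [if_pos (Or.inr h3), columnWt, h4, reflectColumn_self,
          reflectColumn_of_ne _ _ (by omega), reflectColumn_of_ne _ _ (by omega),
          columnWt, columnWt, ← h4, h3]
        ring
      · rw [if_neg (by tauto), columnWt, reflectColumn_of_ne _ _ (by omega),
          reflectColumn_of_ne _ _ (by omega), reflectColumn_of_ne _ _ (by omega), columnWt]
        ring

/-- The height of the columns in `B(ω_r)`. -/
def columnHeight (r : I₂) : ℕ := chainPos r.1 + 1

theorem isColumn_top (r : I₂) : IsColumn (columnHeight r) fun k => (min k (columnHeight r) : ℕ) := by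
  have := chainPos_lt r
  unfold columnHeight
  refine ⟨by simp, ?_, fun k hk => ?_, fun k hk => ?_⟩
  · norm_cast; omega
  · push_cast; omega
  · push_cast; omega

theorem columnWt_top (r : I₂) :
    columnWt (fun k => (min k (columnHeight r) : ℕ)) = Pi.single r 1 := by
  funext j
  unfold columnWt columnHeight
  by_cases h : j = r
  · subst h
    rw [Pi.single_eq_same]
    push_cast
    omega
  · rw [Pi.single_eq_of_ne h]
    have : chainPos j.1 ≠ chainPos r.1 := fun hh => h (chainPos_injective hh)
    push_cast
    omega

/-- Columns are closed under the reflections. Only this inclusion is needed, not that every column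
lies in the orbit. -/
theorem exists_isColumn {r : I₂} {μ : I₂ → ℤ} (h : WeylOrbit (leviCartan I₂) (Pi.single r 1) μ) :
    ∃ N, IsColumn (columnHeight r) N ∧ columnWt N = μ := by
  induction h with
  | base => exact ⟨_, isColumn_top r, columnWt_top r⟩
  | reflect i _ ih =>
    obtain ⟨N, hN, rfl⟩ := ih
    exact ⟨reflectColumn N i, hN.reflect i, columnWt_reflect N i⟩

/-! ### Signature rule for tensor products of columns -/

theorem minuscule_e_eq_some {r i : I₂} {c c' : (minuscule (leviCartan I₂) r).carrier} :
    (minuscule (leviCartan I₂) r).e i c = some c' ↔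
      c.1 i = -1 ∧ c'.1 = simpleReflection (leviCartan I₂) i c.1 := by
  simp only [minuscule]
  split_ifs with h
  · exact ⟨fun hh => ⟨h, congrArg Subtype.val (Option.some.inj hh).symm⟩,
      fun hh => congrArg some (Subtype.ext hh.2.symm)⟩
  · simp [h]

theorem minuscule_f_eq_some {r i : I₂} {c c' : (minuscule (leviCartan I₂) r).carrier} :
    (minuscule (leviCartan I₂) r).f i c = some c' ↔
      c.1 i = 1 ∧ c'.1 = simpleReflection (leviCartan I₂) i c.1 := by
  simp only [minuscule]
  split_ifs with h
  · exact ⟨fun hh => ⟨h, congrArg Subtype.val (Option.some.inj hh).symm⟩,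
      fun hh => congrArg some (Subtype.ext hh.2.symm)⟩
  · simp [h]

theorem minuscule_e_eq_none {r i : I₂} {c : (minuscule (leviCartan I₂) r).carrier} :
    (minuscule (leviCartan I₂) r).e i c = none ↔ c.1 i ≠ -1 := by
  simp [minuscule]

theorem minuscule_wtBounded (r : I₂) : (minuscule (leviCartan I₂) r).WtBounded 1 where
  abs_wt_le c i := by
    obtain ⟨N, hN, h⟩ := exists_isColumn c.2
    change |c.1 i| ≤ _
    rw [← h]
    exact_mod_cast hN.abs_columnWt_le i
  wt_e i c c' h := by
    obtain ⟨h1, h2⟩ := minuscule_e_eq_some.1 h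
    change c'.1 i = c.1 i + 2
    rw [h2]
    simp [simpleReflection, simpleRoot, leviCartan_I₂, h1]
  wt_f i c c' h := by
    obtain ⟨h1, h2⟩ := minuscule_f_eq_some.1 h
    change c'.1 i = c.1 i - 2
    rw [h2]
    simp [simpleReflection, simpleRoot, leviCartan_I₂, h1]

theorem minuscule_eps_le (r i : I₂) (c : (minuscule (leviCartan I₂) r).carrier) :
    (minuscule (leviCartan I₂) r).eps i c ≤ 1 := by
  refine csSup_le' fun k hk => ?_
  have h1 := (minuscule_wtBounded r).le_of_mem_eSet hk
  have h2 := (abs_le.1 ((minuscule_wtBounded r).abs_wt_le c i)).1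
  omega

theorem minuscule_one_le_eps (r i : I₂) (c : (minuscule (leviCartan I₂) r).carrier) :
    1 ≤ (minuscule (leviCartan I₂) r).eps i c ↔ c.1 i = -1 := by
  rw [(minuscule_wtBounded r).one_le_eps_iff, Ne, minuscule_e_eq_none, not_not]

theorem minusculeTensor_wtBounded (l : List I₂) :
    (minusculeTensor (leviCartan I₂) l).WtBounded l.length := by
  induction l with
  | nil => exact ⟨fun b i => by simp [minusculeTensor, trivialCrystal],
      fun i b b' h => by simp [minusculeTensor, trivialCrystal] at h,
      fun i b b' h => by simp [minusculeTensor, trivialCrystal] at h⟩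
  | cons r l ih =>
    rw [List.length_cons, add_comm]
    exact (minuscule_wtBounded r).tensor ih

/-- `x` is a semistandard tableau all of whose columns are bounded by the column with counting
function `N`. -/
def Tableau : (l : List I₂) → (minusculeTensor (leviCartan I₂) l).carrier → (ℕ → ℤ) → Prop
  | [], _, _ => True
  | r :: l, x, N => ∃ M, IsColumn (columnHeight r) M ∧ columnWt M = x.1.1 ∧
      (∀ k ≤ 8, M k ≤ N k) ∧ Tableau l x.2 M

theorem Tableau.mono {l : List I₂} {x : (minusculeTensor (leviCartan I₂) l).carrier}
    {N N' : ℕ → ℤ} (h : Tableau l x N) (hN : ∀ k ≤ 8, N k ≤ N' k) : Tableau l x N' := by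
  cases l with
  | nil => trivial
  | cons r l =>
    obtain ⟨M, h1, h2, h3, h4⟩ := h
    exact ⟨M, h1, h2, fun k hk => (h3 k hk).trans (hN k hk), h4⟩

/-- A column has `ε_i ≤ 1`, so the comparison of `φ_i` with `ε_i` reduces to two questions: whether
the column has weight `-1`, and whether `f_i` kills the remaining factors. -/
theorem tensor_e_cases {r i : I₂} {l : List I₂}
    {x y : (minusculeTensor (leviCartan I₂) (r :: l)).carrier}
    (h : (minusculeTensor (leviCartan I₂) (r :: l)).e i x = some y) :
    (x.1.1 i = -1 ∧ (minusculeTensor (leviCartan I₂) l).f i x.2 = none ∧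
      y.1.1 = simpleReflection (leviCartan I₂) i x.1.1 ∧ y.2 = x.2) ∨
    ((x.1.1 i = -1 → (minusculeTensor (leviCartan I₂) l).f i x.2 ≠ none) ∧ y.1 = x.1 ∧
      (minusculeTensor (leviCartan I₂) l).e i x.2 = some y.2) := by
  have hb := (minusculeTensor_wtBounded l).one_le_phi_iff (i := i) (b := x.2)
  have h1 := minuscule_eps_le r i x.1
  have h2 := minuscule_one_le_eps r i x.1
  simp only [minusculeTensor, tensor] at h
  split_ifs at h with hc <;> obtain ⟨a, ha, rfl⟩ := Option.map_eq_some_iff.1 h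
  · left
    refine ⟨h2.1 (by omega), ?_, (minuscule_e_eq_some.1 ha).2, rfl⟩
    by_contra hf
    have := hb.2 hf
    omega
  · right
    refine ⟨fun hx => hb.1 ?_, rfl, ha⟩
    have := h2.2 hx
    omega

theorem tensor_f_cases {r i : I₂} {l : List I₂}
    {x y : (minusculeTensor (leviCartan I₂) (r :: l)).carrier}
    (h : (minusculeTensor (leviCartan I₂) (r :: l)).f i x = some y) :
    (x.1.1 i = 1 ∧ (minusculeTensor (leviCartan I₂) l).f i x.2 = none ∧
      y.1.1 = simpleReflection (leviCartan I₂) i x.1.1 ∧ y.2 = x.2) ∨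
    (y.1 = x.1 ∧ (minusculeTensor (leviCartan I₂) l).f i x.2 = some y.2) := by
  have hb := (minusculeTensor_wtBounded l).one_le_phi_iff (i := i) (b := x.2)
  have h2 := minuscule_one_le_eps r i x.1
  simp only [minusculeTensor, tensor] at h
  split_ifs at h with hc <;> obtain ⟨a, ha, rfl⟩ := Option.map_eq_some_iff.1 h
  · exact Or.inr ⟨rfl, ha⟩
  · left
    obtain ⟨h3, h4⟩ := minuscule_f_eq_some.1 ha
    refine ⟨h3, ?_, h4, rfl⟩
    by_contra hf
    have h5 := hb.2 hf
    have := h2.1 (by omega)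
    omega

theorem tensor_f_ne_none {r i : I₂} {l : List I₂}
    {x : (minusculeTensor (leviCartan I₂) (r :: l)).carrier} (h : x.1.1 i = 1) :
    (minusculeTensor (leviCartan I₂) (r :: l)).f i x ≠ none := by
  have h2 := minuscule_one_le_eps r i x.1
  simp only [minusculeTensor, tensor]
  split_ifs with hc
  · have := f_ne_none_of_phi (i := i) (b := x.2) (Nat.one_le_of_lt hc)
    simpa using this
  · simp [minuscule, h]

theorem tensor_e_eq_none {r i : I₂} {l : List I₂}
    {x : (minusculeTensor (leviCartan I₂) (r :: l)).carrier}
    (h : (minusculeTensor (leviCartan I₂) (r :: l)).e i x = none) :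
    (x.1.1 i = -1 → (minusculeTensor (leviCartan I₂) l).f i x.2 ≠ none) ∧
      (minusculeTensor (leviCartan I₂) l).e i x.2 = none := by
  have hb := (minusculeTensor_wtBounded l).one_le_phi_iff (i := i) (b := x.2)
  have h2 := minuscule_one_le_eps r i x.1
  simp only [minusculeTensor, tensor] at h
  split_ifs at h with hc
  · have h3 := h2.1 (by omega)
    simp only [Option.map_eq_none_iff, minuscule_e_eq_none] at h
    exact absurd h3 h
  · refine ⟨fun hx => hb.1 ?_, by simpa using h⟩
    have := h2.2 hx
    omega

/-- Lowering a column can only break its comparison with the next column to the right. In that case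
the signature rule would have made `f_i` act further right. -/
theorem Tableau.f {i : I₂} {l : List I₂} {x y : (minusculeTensor (leviCartan I₂) l).carrier}
    {N : ℕ → ℤ} (h : Tableau l x N) (hf : (minusculeTensor (leviCartan I₂) l).f i x = some y) :
    Tableau l y N := by
  have hp := chainPos_lt i
  induction l generalizing N with
  | nil => trivial
  | cons r l ih =>
    obtain ⟨M, h1, h2, h3, h4⟩ := h
    rcases tensor_f_cases hf with ⟨a1, a2, a3, a4⟩ | ⟨a1, a2⟩
    · have hw : columnWt M i = 1 := by rw [h2, a1]
      refine ⟨reflectColumn M i, h1.reflect i, by rw [columnWt_reflect, h2, a3], ?_, ?_⟩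
      · intro k hk
        by_cases hk1 : k = chainPos i.1 + 1
        · subst hk1
          have := h3 _ hk
          rw [reflectColumn_self, hw]; omega
        · rw [reflectColumn_of_ne _ _ hk1]; exact h3 k hk
      · rw [a4]
        cases l with
        | nil => trivial
        | cons r' l =>
          obtain ⟨K, b1, b2, b3, b4⟩ := h4
          refine ⟨K, b1, b2, ?_, b4⟩
          intro k hk
          by_cases hk1 : k = chainPos i.1 + 1
          · subst hk1
            rw [reflectColumn_self, hw]
            by_contra hlt
            -- With `p = chainPos i`: since `K ≤ M`, equality at `p + 1` forces `K` to contain the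
            -- letter `p + 1` and not `p + 2`.
            refine tensor_f_ne_none ?_ a2
            rw [← b2]
            have c1 := b3 _ hk
            have c2 := b3 (chainPos i.1) (by omega)
            have c3 := b3 (chainPos i.1 + 2) (by omega)
            have c4 := b1.le_succ (chainPos i.1) (by omega)
            have c5 := b1.mono (chainPos i.1 + 1) (by omega)
            have c6 := h1.mono (chainPos i.1 + 1) (by omega)
            have c7 := h1.le_succ (chainPos i.1) (by omega)
            unfold columnWt at hw ⊢
            have e : chainPos i.1 + 1 + 1 = chainPos i.1 + 2 := rfl
            rw [e] at c5 c6
            omega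
          · rw [reflectColumn_of_ne _ _ hk1]; exact b3 k hk
    · exact ⟨M, h1, by rw [a1, h2], h3, ih h4 a2⟩

/-- Raising a column can break its comparison with the bound `N` to its left. The hypothesis `hNx`
says that `e_i` would not act on a column `N` placed in front, which is what the induction passes
from each column to the next. -/
theorem Tableau.e {i : I₂} {l : List I₂} {x y : (minusculeTensor (leviCartan I₂) l).carrier}
    {h : ℤ} {N : ℕ → ℤ} (hN : IsColumn h N) (hx : Tableau l x N)
    (hNx : columnWt N i = -1 → (minusculeTensor (leviCartan I₂) l).f i x ≠ none)
    (he : (minusculeTensor (leviCartan I₂) l).e i x = some y) :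
    Tableau l y N := by
  have hp := chainPos_lt i
  induction l generalizing h N with
  | nil => trivial
  | cons r l ih =>
    obtain ⟨M, h1, h2, h3, h4⟩ := hx
    rcases tensor_e_cases he with ⟨a1, a2, a3, a4⟩ | ⟨a1, a2, a3⟩
    · have hw : columnWt M i = -1 := by rw [h2, a1]
      have hle : ∀ k ≤ 8, M k ≤ reflectColumn M i k := by
        intro k hk
        by_cases hk1 : k = chainPos i.1 + 1
        · subst hk1
          rw [reflectColumn_self, hw]; omega
        · rw [reflectColumn_of_ne _ _ hk1]
      refine ⟨reflectColumn M i, h1.reflect i, by rw [columnWt_reflect, h2, a3], ?_,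
        by rw [a4]; exact h4.mono hle⟩
      intro k hk
      by_cases hk1 : k = chainPos i.1 + 1
      · subst hk1
        rw [reflectColumn_self, hw]
        by_contra hlt
        -- With `p = chainPos i`: `N` and `M` agree at `p + 1`, so `M ≤ N` forces `N`, like `M`, to
        -- lack `p + 1` and contain `p + 2`.
        have hNw : columnWt N i = -1 := by
          have c1 := h3 _ hk
          have c2 := h3 (chainPos i.1) (by omega)
          have c3 := h3 (chainPos i.1 + 2) (by omega)
          have c4 := hN.mono (chainPos i.1) (by omega)
          have c5 := hN.le_succ (chainPos i.1 + 1) (by omega)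
          have c6 := h1.le_succ (chainPos i.1 + 1) (by omega)
          have c7 := h1.mono (chainPos i.1) (by omega)
          unfold columnWt at hw ⊢
          have e : chainPos i.1 + 1 + 1 = chainPos i.1 + 2 := rfl
          rw [e] at c5 c6
          omega
        obtain ⟨z, hz⟩ := Option.ne_none_iff_exists'.1 (hNx hNw)
        rcases tensor_f_cases hz with ⟨b1, -⟩ | ⟨-, b2⟩
        · omega
        · rw [a2] at b2; simp at b2
      · rw [reflectColumn_of_ne _ _ hk1]; exact h3 k hk
    · exact ⟨M, h1, by rw [a2, h2], h3, ih h1 h4 (fun hw => a1 (by rw [← h2, hw])) a3⟩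

/-- The counting function of the full column `1, …, 8`. -/
theorem isColumn_natCast : IsColumn 8 fun k => (k : ℤ) :=
  ⟨rfl, rfl, fun k _ => by push_cast; omega, fun k _ => by push_cast; omega⟩

theorem tableau_of_inComponent {l : List I₂} {x y : (minusculeTensor (leviCartan I₂) l).carrier}
    (hx : Tableau l x fun k => (k : ℤ))
    (hy : (minusculeTensor (leviCartan I₂) l).InComponent x y) :
    Tableau l y fun k => (k : ℤ) := by
  induction hy with
  | base => exact hx
  | e _ h ih =>
    -- The full column has weight `0` at every node, so the condition on the bound is vacuous.
    refine ih.e isColumn_natCast (fun hw => ?_) h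
    simp only [columnWt] at hw
    push_cast at hw
    omega
  | f _ h ih => exact ih.f h

theorem tableau_top {l : List I₂} (hl : l.Pairwise fun r r' => columnHeight r' ≤ columnHeight r)
    {N : ℕ → ℤ} (hN : ∀ r ∈ l, ∀ k ≤ 8, ((min k (columnHeight r) : ℕ) : ℤ) ≤ N k) :
    Tableau l (minusculeTensorTop (leviCartan I₂) l) N := by
  induction l generalizing N with
  | nil => trivial
  | cons r l ih =>
    rw [List.pairwise_cons] at hl
    refine ⟨_, isColumn_top r, columnWt_top r, hN r (by simp), ih hl.2 fun r' hr' k _ => ?_⟩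
    have := hl.1 r' hr'
    push_cast
    omega

/-! ### Highest weight tableaux for `A_6` -/

/-- `x` is the tableau whose `j`-th column has counting function `min k v_j` for `k ≤ 7`. -/
def HasShape : (l : List I₂) → (minusculeTensor (leviCartan I₂) l).carrier → List ℕ → Prop
  | [], _, v => v = []
  | r :: l, x, v => ∃ q v', v = q :: v' ∧ q ≤ columnHeight r ∧ columnHeight r ≤ q + 1 ∧
      x.1.1 = columnWt (fun k => if k ≤ 7 then ((min k q : ℕ) : ℤ) else columnHeight r) ∧
      HasShape l x.2 v'

theorem HasShape.unique {l : List I₂} {x y : (minusculeTensor (leviCartan I₂) l).carrier}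
    {v : List ℕ} (hx : HasShape l x v) (hy : HasShape l y v) : x = y := by
  induction l generalizing v with
  | nil => rfl
  | cons r l ih =>
    obtain ⟨q, v', rfl, -, -, h1, h2⟩ := hx
    obtain ⟨q', v'', h, -, -, h3, h4⟩ := hy
    obtain ⟨rfl, rfl⟩ := List.cons.inj h
    exact Prod.ext (Subtype.ext (h1.trans h3.symm)) (ih h2 h4)

theorem columnWt_min {q h : ℕ} {i : I₂} (hi : i.1 ≠ 0) :
    columnWt (fun k => if k ≤ 7 then ((min k q : ℕ) : ℤ) else h) i =
      if q = chainPos i.1 + 1 then 1 else 0 := by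
  have := (chainPos_zero_iff i).1 hi
  simp only [columnWt]
  rw [if_pos (show chainPos i.1 + 1 ≤ 7 by omega), if_pos (show chainPos i.1 ≤ 7 by omega),
    if_pos (show chainPos i.1 + 2 ≤ 7 by omega)]
  push_cast
  split_ifs <;> omega

theorem HasShape.mem_of_f_ne_none {l : List I₂}
    {x : (minusculeTensor (leviCartan I₂) l).carrier} {v : List ℕ} (hx : HasShape l x v)
    {i : I₂} (hi : i.1 ≠ 0)
    (hf : (minusculeTensor (leviCartan I₂) l).f i x ≠ none) : chainPos i.1 + 1 ∈ v := by
  induction l generalizing v with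
  | nil => simp [minusculeTensor, trivialCrystal] at hf
  | cons r l ih =>
    obtain ⟨q, v', rfl, -, -, h1, h2⟩ := hx
    obtain ⟨y, hy⟩ := Option.ne_none_iff_exists'.1 hf
    rcases tensor_f_cases hy with ⟨a1, -⟩ | ⟨-, a2⟩
    · rw [h1, columnWt_min hi] at a1
      split_ifs at a1 with hq
      · simp [hq]
      · omega
    · exact List.mem_cons_of_mem _
        (ih h2 (by rw [a2]; simp))

theorem HasShape.wt_eq_count {l : List I₂}
    {x : (minusculeTensor (leviCartan I₂) l).carrier} {v : List ℕ} (hx : HasShape l x v)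
    {i : I₂} (hi : i.1 ≠ 0) :
    (minusculeTensor (leviCartan I₂) l).wt x i = v.count (chainPos i.1 + 1) := by
  induction l generalizing v with
  | nil => rw [show v = [] from hx]; rfl
  | cons r l ih =>
    obtain ⟨q, v', rfl, -, -, h1, h2⟩ := hx
    have h3 := ih h2
    change x.1.1 i + (minusculeTensor (leviCartan I₂) l).wt x.2 i = _
    rw [h3, h1, columnWt_min hi, List.count_cons]
    simp only [beq_iff_eq]
    split_ifs <;> push_cast <;> ring

/-- Without weight `-1` at a node of `A_6`, a missing letter forces the next one up to `7` to be
missing as well. The letters `≤ 7` therefore form an initial segment. -/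
theorem IsColumn.eq_min {h : ℤ} {M : ℕ → ℤ} (hM : IsColumn h M)
    (hw : ∀ i : I₂, i.1 ≠ 0 → columnWt M i ≠ -1) {q : ℕ} (hq : M 7 = q) {k : ℕ} (hk : k ≤ 7) :
    M k = (min k q : ℕ) := by
  have key : ∀ p < 6, M (p + 1) = M p → M (p + 2) = M (p + 1) := by
    intro p hp hpp
    obtain ⟨i, hi⟩ := exists_chainPos (show p < 7 by omega)
    have h1 := hw i ((chainPos_zero_iff i).2 (by omega))
    have h2 := hM.mono (p + 1) (by omega)
    have h3 := hM.le_succ (p + 1) (by omega)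
    unfold columnWt at h1
    rw [hi] at h1
    have e : p + 1 + 1 = p + 2 := rfl
    rw [e] at h2 h3
    omega
  have up : ∀ j ≤ 7, M j = j ∨ ∀ k, j ≤ k → k ≤ 7 → M k = M j := by
    intro j
    induction j with
    | zero => intro _; left; simpa using hM.zero
    | succ j ih =>
      intro hj
      rcases ih (by omega) with h1 | h1
      · have h2 := hM.mono j (by omega)
        have h3 := hM.le_succ j (by omega)
        by_cases h4 : M (j + 1) = M j
        · right
          intro k hk1 hk2
          induction k, hk1 using Nat.le_induction with
          | base => rfl
          | succ k hk ih2 =>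
            have hstep : ∀ n, j ≤ n → n + 1 ≤ 7 → M (n + 1) = M n := by
              intro n hn hn7
              induction n, hn using Nat.le_induction with
              | base => exact h4
              | succ n hn ih3 => exact key n (by omega) (ih3 (by omega))
            rw [hstep k (by omega) hk2]
            exact ih2 (by omega)
        · left
          push_cast
          omega
      · right
        intro k hk1 hk2
        rw [h1 k (by omega) hk2, h1 (j + 1) (by omega) hj]
  have mono7 : ∀ k ≤ 7, M k ≤ M 7 := by
    intro k hk
    induction hk using Nat.decreasingInduction with
    | self => exact le_rfl
    | of_succ k hk ih => exact (hM.mono k (by omega)).trans ih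
  rcases up k hk with h1 | h1
  · have := mono7 k hk
    push_cast
    omega
  · have h2 := h1 7 hk le_rfl
    have h3 := hM.le_self (k := k) (by omega)
    push_cast
    omega

/-- The columns are treated from right to left. The bound `q ≤ N q` says that the column to the left
contains `1, …, q`, which excludes weight `-1` there; `q ≤ N 7` makes `v` decreasing. -/
theorem Tableau.exists_hasShape {l : List I₂}
    {x : (minusculeTensor (leviCartan I₂) l).carrier} {N : ℕ → ℤ} (hx : Tableau l x N)
    (he : ∀ i : I₂, i.1 ≠ 0 → (minusculeTensor (leviCartan I₂) l).e i x = none) :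
    ∃ v : List ℕ, HasShape l x v ∧ v.Pairwise (· ≥ ·) ∧ (∀ q ∈ v, q ≤ 7 ∧ (q : ℤ) ≤ N q ∧
      (q : ℤ) ≤ N 7) := by
  induction l generalizing N with
  | nil => exact ⟨[], rfl, List.Pairwise.nil, by simp⟩
  | cons r l ih =>
    obtain ⟨M, h1, h2, h3, h4⟩ := hx
    obtain ⟨v, hv1, hv2, hv3⟩ := ih h4 fun i hi => (tensor_e_eq_none (he i hi)).2
    have hw : ∀ i : I₂, i.1 ≠ 0 → columnWt M i ≠ -1 := by
      intro i hi hwi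
      have hp := chainPos_lt i
      have hf := (tensor_e_eq_none (he i hi)).1 (by rw [← h2, hwi])
      -- A `+` in this column must be cancelled from the right, so some later column has `q =
      -- chainPos i + 1`. Then this column already contains `1, …, q`, contradicting the weight
      -- `-1`.
      have hmem := hv1.mem_of_f_ne_none hi hf
      have c1 := (hv3 _ hmem).2.1
      have c2 := h1.le_self (k := chainPos i.1) (by omega)
      have c3 := h1.mono (chainPos i.1 + 1) (by omega)
      have c4 := h1.le_succ (chainPos i.1 + 1) (by omega)
      unfold columnWt at hwi
      have e : chainPos i.1 + 1 + 1 = chainPos i.1 + 2 := rfl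
      rw [e] at c3 c4
      push_cast at c1
      omega
    obtain ⟨q, hq⟩ := Int.eq_ofNat_of_zero_le (h1.nonneg (k := 7) (by omega))
    have hmin := fun k hk => h1.eq_min hw hq (k := k) hk
    have h7 := h1.le_self (k := 7) (by omega)
    have g1 := h1.mono 7 (by omega)
    have g2 := h1.le_succ 7 (by omega)
    have g3 := h1.eight
    norm_num at g1 g2
    have hq7 : q ≤ 7 := by rw [hq] at h7; exact_mod_cast h7
    refine ⟨q :: v, ⟨q, v, rfl, by omega, by omega, ?_, hv1⟩, ?_, ?_⟩
    · rw [← h2]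
      funext i
      have hp := chainPos_lt i
      have hMk : ∀ k ≤ 8, M k =
          if k ≤ 7 then ((min k q : ℕ) : ℤ) else columnHeight r := by
        intro k hk
        split_ifs with hk7
        · exact hmin k hk7
        · rw [show k = 8 by omega, g3]
      simp only [columnWt]
      rw [hMk _ (by omega), hMk _ (by omega), hMk _ (by omega)]
    · refine List.pairwise_cons.2 ⟨fun q' hq' => ?_, hv2⟩
      have := (hv3 q' hq').2.2
      omega
    · intro q' hq'
      have n7 := h3 7 (by omega)
      rcases List.mem_cons.1 hq' with rfl | hq'
      · have := hmin q' hq7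
        have := h3 q' (by omega)
        rw [min_self] at *
        exact ⟨hq7, by omega, by omega⟩
      · obtain ⟨d1, d2, d3⟩ := hv3 q' hq'
        have := h3 q' (by omega)
        exact ⟨d1, by omega, by omega⟩

/-! ### Multiplicity-free branching from `A_7` to `A_6` -/

/-- The fundamental weights that occur in the highest weight `μ` attached to a parameter. -/
def paramList {s : ℕ} (p : Param s) : List I₂ :=
  List.replicate (p.m₇ - (p.m₄ + p.m₅)) ⟨1, by decide⟩ ++
    List.replicate p.m₅ ⟨4, by decide⟩ ++ List.replicate p.m₆ ⟨6, by decide⟩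

theorem columnHeight_of_mem_paramList {s : ℕ} {p : Param s} {r : I₂} (hr : r ∈ paramList p) :
    columnHeight r = 6 ∨ columnHeight r = 4 ∨ columnHeight r = 2 := by
  simp only [paramList, List.mem_append, List.mem_replicate] at hr
  rcases hr with (⟨_, rfl⟩ | ⟨_, rfl⟩) | ⟨_, rfl⟩ <;> decide

theorem paramList_pairwise {s : ℕ} (p : Param s) :
    (paramList p).Pairwise fun r r' => columnHeight r' ≤ columnHeight r := by
  simp only [paramList, List.pairwise_append, List.pairwise_replicate, List.mem_append,
    List.mem_replicate]
  refine ⟨⟨Or.inr le_rfl, Or.inr le_rfl, ?_⟩, Or.inr le_rfl, ?_⟩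
  · rintro a ⟨_, rfl⟩ b ⟨_, rfl⟩
    decide
  · rintro a (⟨_, rfl⟩ | ⟨_, rfl⟩) b ⟨_, rfl⟩ <;> decide

theorem paramList_injective {s : ℕ} {p p' : Param s} (h : paramList p = paramList p') :
    p = p' := by
  have key : ∀ r : I₂, (paramList p).count r = (paramList p').count r := fun r => by rw [h]
  have h1 := key ⟨1, by decide⟩
  have h4 := key ⟨4, by decide⟩
  have h6 := key ⟨6, by decide⟩
  simp [paramList, List.count_replicate] at h1 h4 h6
  obtain ⟨a, b, c, d, hle, hs⟩ := p
  obtain ⟨a', b', c', d', hle', hs'⟩ := p'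
  simp only [Param.mk.injEq] at *
  -- The multiplicities give `m₅`, `m₆` and `a = m₇ - m₄ - m₅`; then `s = a + 2 m₄ + 2 m₅ + m₆`
  -- fixes `m₄`, hence `m₇`.
  omega

theorem paramList_length_le {s : ℕ} (p : Param s) : (paramList p).length ≤ s := by
  have := p.sum_eq
  have := p.le
  simp [paramList]
  omega

theorem crystalA7_wtBounded (s : ℕ) : (crystalA7 s).WtBounded s :=
  WtBounded.directSum fun p =>
    ((minusculeTensor_wtBounded (paramList p)).mono (paramList_length_le p)).component _

/-- Values `q = 0` and `q = 7` would be invisible to the `A_6` weight; heights between `2` and `6`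
exclude them. -/
theorem HasShape.pos {l : List I₂} {x : (minusculeTensor (leviCartan I₂) l).carrier}
    {v : List ℕ} (hx : HasShape l x v) (hl : ∀ r ∈ l, 2 ≤ columnHeight r ∧ columnHeight r ≤ 6) :
    ∀ q ∈ v, 1 ≤ q ∧ q ≤ 6 := by
  induction l generalizing v with
  | nil => rw [show v = [] from hx]; simp
  | cons r l ih =>
    obtain ⟨q, v', rfl, h1, h2, -, h3⟩ := hx
    have := hl r (by simp)
    intro q' hq'
    rcases List.mem_cons.1 hq' with rfl | hq'
    · omega
    · exact ih h3 (fun r hr => hl r (List.mem_cons_of_mem _ hr)) q' hq'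

/-- Each height is `q` or `q + 1`, and parity decides which. -/
theorem HasShape.list_eq {l l' : List I₂} {x : (minusculeTensor (leviCartan I₂) l).carrier}
    {x' : (minusculeTensor (leviCartan I₂) l').carrier} {v : List ℕ}
    (hx : HasShape l x v) (hx' : HasShape l' x' v) (hl : ∀ r ∈ l, Even (columnHeight r))
    (hl' : ∀ r ∈ l', Even (columnHeight r)) : l = l' := by
  induction l generalizing l' v with
  | nil =>
    cases l' with
    | nil => rfl
    | cons r' l' =>
      obtain ⟨q, v', rfl, -⟩ := hx'
      exact absurd hx (by simp [HasShape])
  | cons r l ih =>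
    cases l' with
    | nil =>
      obtain ⟨q, v', rfl, -⟩ := hx
      exact absurd hx' (by simp [HasShape])
    | cons r' l' =>
      obtain ⟨q, v', rfl, h1, h2, -, h3⟩ := hx
      obtain ⟨q', v'', h, h1', h2', -, h3'⟩ := hx'
      obtain ⟨rfl, rfl⟩ := List.cons.inj h
      have e1 := hl r (by simp)
      have e2 := hl' r' (by simp)
      have : columnHeight r = columnHeight r' := by
        rw [Nat.even_iff] at e1 e2
        omega
      have hr : r = r' := chainPos_injective (by unfold columnHeight at this; omega)
      rw [hr, ih h3 h3' (fun r hr => hl r (List.mem_cons_of_mem _ hr))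
        (fun r hr => hl' r (List.mem_cons_of_mem _ hr))]

theorem crystalA7_exists_hasShape {s : ℕ} (p : Param s)
    (x : (highestWeightCrystal (leviCartan I₂) (paramList p)).carrier)
    (he : ∀ i : I₂, i.1 ≠ 0 →
      (highestWeightCrystal (leviCartan I₂) (paramList p)).e i x = none) :
    ∃ v : List ℕ, HasShape (paramList p) x.1 v ∧ v.Pairwise (· ≥ ·) ∧
      ∀ q ∈ v, 1 ≤ q ∧ q ≤ 6 := by
  have htop : Tableau (paramList p) (minusculeTensorTop (leviCartan I₂) (paramList p))
      fun k => (k : ℤ) := tableau_top (paramList_pairwise p) fun r _ k _ => by push_cast; omega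
  have hx := tableau_of_inComponent htop x.2
  obtain ⟨v, h1, h2, -⟩ := hx.exists_hasShape fun i hi => by
    have := he i hi
    simpa [highestWeightCrystal, component] using this
  refine ⟨v, h1, h2, h1.pos fun r hr => ?_⟩
  rcases columnHeight_of_mem_paramList hr with h | h | h <;> omega

/-- The restriction of the crystal to `A_6` is multiplicity free. -/
theorem crystalA7_multiplicityFree {s : ℕ} (x y : (crystalA7 s).carrier)
    (hx : ∀ i : I₂, i.1 ≠ 0 → (crystalA7 s).e i x = none)
    (hy : ∀ i : I₂, i.1 ≠ 0 → (crystalA7 s).e i y = none)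
    (hwt : ∀ i : I₂, i.1 ≠ 0 → (crystalA7 s).wt x i = (crystalA7 s).wt y i) : x = y := by
  obtain ⟨p, x⟩ := x
  obtain ⟨p', y⟩ := y
  obtain ⟨v, hv1, hv2, hv3⟩ := crystalA7_exists_hasShape p x fun i hi => by
    have := hx i hi
    exact Option.map_eq_none_iff.1 this
  obtain ⟨v', hv1', hv2', hv3'⟩ := crystalA7_exists_hasShape p' y fun i hi => by
    have := hy i hi
    exact Option.map_eq_none_iff.1 this
  -- The `A_6` weight coordinates are the multiplicities of `1, …, 6`, and a sorted list is
  -- determined by its multiplicities.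
  have hvv : v = v' := by
    refine List.Perm.eq_of_pairwise (fun a b _ _ h1 h2 => le_antisymm h2 h1) hv2 hv2' ?_
    rw [List.perm_iff_count]
    intro q
    by_cases hq : 1 ≤ q ∧ q ≤ 6
    · obtain ⟨i, hi⟩ := exists_chainPos (show q - 1 < 7 by omega)
      have hi0 : i.1 ≠ 0 := (chainPos_zero_iff i).2 (by omega)
      have h1 := hv1.wt_eq_count hi0
      have h2 := hv1'.wt_eq_count hi0
      have h3 : (minusculeTensor (leviCartan I₂) (paramList p)).wt x.1 i =
        (minusculeTensor (leviCartan I₂) (paramList p')).wt y.1 i := hwt i hi0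
      rw [h1, h2, show chainPos i.1 + 1 = q by omega] at h3
      exact_mod_cast h3
    · rw [List.count_eq_zero.2 fun h => hq (hv3 q h), List.count_eq_zero.2 fun h => hq (hv3' q h)]
  subst hvv
  have heven : ∀ (p : Param s), ∀ r ∈ paramList p, Even (columnHeight r) := by
    intro p r hr
    rcases columnHeight_of_mem_paramList hr with h | h | h <;> rw [h] <;> decide
  obtain rfl := paramList_injective (hv1.list_eq hv1' (heven p) (heven p'))
  congr 1
  exact Subtype.ext (hv1.unique hv1')

/-! ### Comparison of the two isomorphisms and gluing -/

/-- The pairing with `2ρᵛ` of type `A_6`. -/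
def twoRho (μ : Fin 8 → ℤ) : ℤ :=
  6 * μ 7 + 10 * μ 6 + 12 * μ 5 + 12 * μ 4 + 10 * μ 3 + 6 * μ 1

theorem twoRho_sub_simpleRoot (μ : Fin 8 → ℤ) {i : Fin 8} (h0 : i ≠ 0) (h2 : i ≠ 2) :
    twoRho (μ - simpleRoot cartanE7Affine i) = twoRho μ - 2 := by
  have : ∀ i : Fin 8, i ≠ 0 → i ≠ 2 → twoRho (simpleRoot cartanE7Affine i) = 2 := by decide
  rw [← this i h0 h2]
  simp only [twoRho, Pi.sub_apply]
  ring

theorem toFun_eq_toFun {s : ℕ} {B : CrystalData.{u} (Fin 8)} {B' : CrystalData.{v} (Fin 8)}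
    (hB : B.IsCrystal cartanE7Affine) (hB' : B'.IsCrystal cartanE7Affine)
    (Ψ₂ : (B.restrict I₂).Iso (B'.restrict I₂)) (Ψ₀ : (B.restrict I₀).Iso (B'.restrict I₀))
    (Φ : (B'.restrict I₂).Iso (crystalA7 s)) (b : B.carrier) :
    Ψ₂.toFun (some b) = Ψ₀.toFun (some b) := by
  -- Each coordinate is at most `s`, and the coefficients of `twoRho` add up to `56`.
  have hbound : ∀ b : B.carrier, twoRho (B.wt b) ≤ 56 * s := by
    intro b
    obtain ⟨c, hc⟩ := Ψ₂.map_some b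
    obtain ⟨d, hd⟩ := Φ.map_some c
    have hle : ∀ i : I₂, B.wt b i.1 ≤ s := by
      intro i
      have h1 := (abs_le.1 ((crystalA7_wtBounded s).abs_wt_le d i)).2
      rw [Φ.wt_eq c d hd, Ψ₂.wt_eq b c hc] at h1
      exact h1
    have h7 := hle ⟨7, by decide⟩
    have h6 := hle ⟨6, by decide⟩
    have h5 := hle ⟨5, by decide⟩
    have h4 := hle ⟨4, by decide⟩
    have h3 := hle ⟨3, by decide⟩
    have h1 := hle ⟨1, by decide⟩
    simp only [twoRho]
    linarith
  -- Induction on the distance to this bound: each `e_i` with `i` in `A_6` raises `twoRho` by `2`.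
  generalize hn : (56 * s - twoRho (B.wt b)).toNat = n
  induction n using Nat.strong_induction_on generalizing b with
  | _ n ih =>
    by_cases hw : ∀ i : Fin 8, i ≠ 0 → i ≠ 2 → B.e i b = none
    · obtain ⟨c₂, hc₂⟩ := Ψ₂.map_some b
      obtain ⟨c₀, hc₀⟩ := Ψ₀.map_some b
      obtain ⟨d₂, hd₂⟩ := Φ.map_some c₂
      obtain ⟨d₀, hd₀⟩ := Φ.map_some c₀
      -- Both images of `b` are `A_6` highest weight elements of the same `A_6` weight.
      have hd : d₂ = d₀ := by
        apply crystalA7_multiplicityFree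
        · intro i hi
          exact Φ.e_eq_none ((crystalA7_wtBounded s).bdd_eSet i d₂) hd₂
            (Ψ₂.e_eq_none (hB'.bdd_eSet i.1 c₂) hc₂ (hw i.1 hi i.2))
        · intro i hi
          exact Φ.e_eq_none ((crystalA7_wtBounded s).bdd_eSet i d₀) hd₀
            (Ψ₀.e_eq_none (i := ⟨i.1, hi⟩) (hB'.bdd_eSet i.1 c₀) hc₀ (hw i.1 hi i.2))
        · intro i hi
          rw [Φ.wt_eq _ _ hd₂, Φ.wt_eq _ _ hd₀, Ψ₂.wt_eq _ _ hc₂]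
          exact (congrFun (Ψ₀.wt_eq _ _ hc₀) ⟨i.1, hi⟩).symm
      rw [hc₂, hc₀]
      apply Φ.bijective.1
      exact hd₂.trans ((congrArg some hd).trans hd₀.symm)
    · push Not at hw
      obtain ⟨i, h0, h2, hi⟩ := hw
      obtain ⟨c, hc⟩ := Option.ne_none_iff_exists'.1 hi
      have hf := (hB.f_eq_iff i c b).2 hc
      have hwt := twoRho_sub_simpleRoot (B.wt c) h0 h2
      rw [← hB.wt_f i c b hf] at hwt
      have hcb := hbound c
      have hrec := ih _ (by omega) c rfl
      have e₂ := Ψ₂.map_f_of_ne_none (i := ⟨i, h2⟩) (b := c) (hB.bdd_fSet i c)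
        (by change B.f i c ≠ none; simp [hf])
      have e₀ := Ψ₀.map_f_of_ne_none (i := ⟨i, h0⟩) (b := c) (hB.bdd_fSet i c)
        (by change B.f i c ≠ none; simp [hf])
      change Ψ₂.toFun (B.f i c) = (Ψ₂.toFun (some c)).bind (B'.f i) at e₂
      change Ψ₀.toFun (B.f i c) = (Ψ₀.toFun (some c)).bind (B'.f i) at e₀
      rw [hf] at e₂ e₀
      exact e₂.trans ((congrArg (fun x => x.bind (B'.f i)) hrec).trans e₀.symm)

/-- Two isomorphisms over subsets covering the index set with the same underlying map combine. -/
def Iso.glue {J : Type w} {B : CrystalData.{u} J} {B' : CrystalData.{v} J} {K L : Set J}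
    (hKL : ∀ j, j ∉ K → j ∈ L) (Ψ : (B.restrict K).Iso (B'.restrict K))
    (Θ : (B.restrict L).Iso (B'.restrict L)) (h : Θ.toFun = Ψ.toFun) : B.Iso B' where
  toFun := Ψ.toFun
  map_zero := Ψ.map_zero
  wt_eq b b' hb := by
    funext j
    by_cases hj : j ∈ K
    · exact congrFun (Ψ.wt_eq b b' hb) ⟨j, hj⟩
    · exact congrFun (Θ.wt_eq b b' (by rw [h]; exact hb)) ⟨j, hKL j hj⟩
  eps_eq j b b' hb := by
    by_cases hj : j ∈ K
    · exact Ψ.eps_eq ⟨j, hj⟩ b b' hb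
    · exact Θ.eps_eq ⟨j, hKL j hj⟩ b b' (by rw [h]; exact hb)
  phi_eq j b b' hb := by
    by_cases hj : j ∈ K
    · exact Ψ.phi_eq ⟨j, hj⟩ b b' hb
    · exact Θ.phi_eq ⟨j, hKL j hj⟩ b b' (by rw [h]; exact hb)
  map_e j b := by
    by_cases hj : j ∈ K
    · exact Ψ.map_e ⟨j, hj⟩ b
    · have := Θ.map_e ⟨j, hKL j hj⟩ b
      rw [h] at this
      exact this
  map_f j b := by
    by_cases hj : j ∈ K
    · exact Ψ.map_f ⟨j, hj⟩ b
    · have := Θ.map_f ⟨j, hKL j hj⟩ b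
      rw [h] at this
      exact this
  bijective := Ψ.bijective

end E7Crystal

theorem mainTheorem2 (s : ℕ)
    (B : E7Crystal.CrystalData.{u} (Fin 8)) (B' : E7Crystal.CrystalData.{v} (Fin 8))
    (hB : B.IsCrystal E7Crystal.cartanE7Affine) (hB' : B'.IsCrystal E7Crystal.cartanE7Affine)
    (Ψ₂ : (B.restrict E7Crystal.I₂).Iso (B'.restrict E7Crystal.I₂))
    (Ψ₀ : (B.restrict E7Crystal.I₀).Iso (B'.restrict E7Crystal.I₀))
    (h₂ : Nonempty ((B'.restrict E7Crystal.I₂).Iso (E7Crystal.crystalA7 s)))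
    (h₀ : Nonempty ((B'.restrict E7Crystal.I₀).Iso (E7Crystal.crystalE7 s))) :
    (∀ b : B.carrier, Ψ₂.toFun (some b) = Ψ₀.toFun (some b)) ∧
      ∃ Ψ : B.Iso B', ∀ b : B.carrier, Ψ.toFun (some b) = Ψ₀.toFun (some b) := by
  obtain ⟨Φ⟩ := h₂
  have key := E7Crystal.toFun_eq_toFun hB hB' Ψ₂ Ψ₀ Φ
  refine ⟨key, E7Crystal.Iso.glue (fun j hj => ?_) Ψ₀ Ψ₂ ?_, fun b => rfl⟩
  · have : j = 0 := not_not.1 hj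
    subst this
    decide
  · funext x
    cases x with
    | none => exact Ψ₂.map_zero.trans Ψ₀.map_zero.symm
    | some b => exact key b
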